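/- A polynomial mapping $F=(P,Q)\in\mathbb{C}[X,Y]^2$ of $\mathbb{C}^2$ is called a normalized Keller mapping if $\det J_F\equiv 1$ (so that $F$ is étale), $\deg P=\deg_Y P$ and $\deg Q=\deg_Y Q$, where $\deg$ is the total degree and $\deg_Y$ the degree in $Y$. Let ${\rm et}(\mathbb{C}^2)$ be the set of all normalized Keller mappings, and let ${\rm Aut}(\mathbb{C}^2)$ be the group of polynomial automorphisms of $\mathbb{C}^2$, i.e. of polynomial mappings with a polynomial inverse. A mapping $F\in{\rm et}(\mathbb{C}^2)$ is called composite if $F=G\circ H$ for some $G,H\in{\rm et}(\mathbb{C}^2)\setminus{\rm Aut}(\mathbb{C}^2)$. A mapping in ${\rm et}(\mathbb{C}^2)\setminus{\rm Aut}(\mathbb{C}^2)$ is called prime if it is not composite, and ${\rm et}_p(\mathbb{C}^2)$ denotes the set of all prime mappings. **Theorem 4.5.** 1. If ${\rm et}(\mathbb{C}^2)\setminus{\rm Aut}(\mathbb{C}^2)\neq\emptyset$, then ${\rm et}_p(\mathbb{C}^2)\neq\emptyset$. 2. For every $F\in{\rm et}(\mathbb{C}^2)$ there are an integer $k\ge 0$,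 an automorphism $A_0\in{\rm Aut}(\mathbb{C}^2)$ and prime mappings $P_1,\dots,P_k\in{\rm et}_p(\mathbb{C}^2)$ such that $F=A_0\circ P_1\circ\cdots\circ P_k$. -/

import Mathlib

namespace PlaneMap

/-- A polynomial mapping `F = (P, Q)` of the affine plane `ℂ²`, given by its two components
`P = F 0`, `Q = F 1` in `ℂ[X, Y]`, where `X = MvPolynomial.X 0` and `Y = MvPolynomial.X 1`. -/
abbrev PolyMap : Type := Fin 2 → MvPolynomial (Fin 2) ℂ

/-- The identity mapping `(X, Y)`. -/
noncomputable def ident : PolyMap := fun i => MvPolynomial.X i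

/-- The composition `F ∘ G`: substitute the components of `G` for the variables in those of `F`. -/
noncomputable def comp (F G : PolyMap) : PolyMap := fun i => MvPolynomial.bind₁ G (F i)

/-- The composition `P₁ ∘ ⋯ ∘ Pₖ` of a finite sequence (the identity for `k = 0`). -/
noncomputable def compSeq {k : ℕ} (P : Fin k → PolyMap) : PolyMap :=
  (List.ofFn P).foldr comp ident

/-- The Jacobian matrix `J_F`. -/
noncomputable def jacobian (F : PolyMap) : Matrix (Fin 2) (Fin 2) (MvPolynomial (Fin 2) ℂ) :=
  Matrix.of fun i j => MvPolynomial.pderiv j (F i)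

/-- `Aut(ℂ²)`: the polynomial automorphisms, i.e. the polynomial mappings with a two-sided
polynomial inverse. -/
def Aut : Set PolyMap := {F | ∃ G : PolyMap, comp F G = ident ∧ comp G F = ident}

/-- `et(ℂ²)`: the normalized Keller mappings `F = (P, Q)`, i.e. those with `det J_F ≡ 1`,
`deg P = deg_Y P` and `deg Q = deg_Y Q`. Such a mapping is a local homeomorphism at every point
of `ℂ²`, by the inverse function theorem, so that being étale is not a further condition. -/
def Et : Set PolyMap :=
  {F | (jacobian F).det = 1 ∧ ∀ i, (F i).totalDegree = (F i).degreeOf 1}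

/-- `F ∈ et(ℂ²)` is composite if `F = G ∘ H` for some `G, H ∈ et(ℂ²) - Aut(ℂ²)`. -/
def IsComposite (F : PolyMap) : Prop :=
  F ∈ Et ∧ ∃ G ∈ Et \ Aut, ∃ H ∈ Et \ Aut, F = comp G H

/-- `etₚ(ℂ²)`: the prime mappings, i.e. the elements of `et(ℂ²) - Aut(ℂ²)` that are
not composite. -/
def EtPrime : Set PolyMap := {F | F ∈ Et \ Aut ∧ ¬ IsComposite F}

end PlaneMap

namespace PlaneMap

open MvPolynomial

/-! The geometric degree `[ℂ(X, Y) : ℂ(P, Q)]` of a Keller map is finite and multiplicative under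
composition (`geomDegree_comp`), and degree 1 forces an automorphism
(`mem_Aut_of_geomDegree_eq_one`). Hence both factors of a composite map have strictly smaller
degree, and splitting ends in primes. So `A₀` can be the identity, unless `F` is itself an
automorphism; then `k = 0`. -/

theorem comp_assoc (F G H : PolyMap) : comp (comp F G) H = comp F (comp G H) := by
  funext i
  exact bind₁_bind₁ G H (F i)

theorem ident_comp (F : PolyMap) : comp ident F = F := by
  funext i
  simp [comp, ident]

theorem comp_ident (F : PolyMap) : comp F ident = F := by
  funext i
  exact aeval_X_left_apply (F i)

theorem ident_mem_Aut : ident ∈ Aut := ⟨ident, ident_comp _, ident_comp _⟩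

/-! ### Substitution into polynomials and the Jacobian -/

/-- The chain rule for partial derivatives. -/
theorem pderiv_bind₁ {σ τ R : Type*} [CommSemiring R] [Fintype σ]
    (F : σ → MvPolynomial τ R) (j : τ) (p : MvPolynomial σ R) :
    pderiv j (bind₁ F p) = ∑ i, bind₁ F (pderiv i p) * pderiv j (F i) := by
  classical
  induction p using MvPolynomial.induction_on with
  | C a => simp
  | add p q hp hq => simp [hp, hq, add_mul, Finset.sum_add_distrib]
  | mul_X p k hp =>
    simp only [map_mul, bind₁_X_right, pderiv_mul, map_add, hp, pderiv_X, add_mul,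
      Finset.sum_add_distrib, Finset.sum_mul]
    congr 1
    · exact Finset.sum_congr rfl fun i _ => by ring
    · rw [Finset.sum_eq_single k]
      · simp
      · intro b _ hb
        simp [hb.symm]
      · simp

theorem totalDegree_pderiv_lt {σ R : Type*} [CommSemiring R] {p : MvPolynomial σ R} {i : σ}
    (h : pderiv i p ≠ 0) : (pderiv i p).totalDegree < p.totalDegree := by
  obtain ⟨m, hm, hdeg⟩ := Finset.exists_mem_eq_sup _ (support_nonempty.2 h) (fun s => s.sum fun _ e => e)
  have hdeg' : (pderiv i p).totalDegree = m.sum fun _ e => e := hdeg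
  rw [mem_support_iff, coeff_pderiv] at hm
  have h1 := le_totalDegree (mem_support_iff.2 (left_ne_zero_of_mul hm))
  rw [Finsupp.sum_add_index' (by simp) (by simp), Finsupp.sum_single_index rfl] at h1
  omega

theorem eq_C_of_pderiv_eq_zero {σ R : Type*} [CommRing R] [IsDomain R] [CharZero R]
    {p : MvPolynomial σ R} (h : ∀ i, pderiv i p = 0) : p = C (coeff 0 p) := by
  classical
  ext m
  rw [coeff_C]
  split_ifs with hm
  · rw [hm]
  · obtain ⟨i, hi⟩ := Finsupp.ne_iff.1 (Ne.symm hm)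
    have h1 : coeff (m - Finsupp.single i 1) (pderiv i p) = 0 := by rw [h i, coeff_zero]
    have h2 : m - Finsupp.single i 1 + Finsupp.single i 1 = m :=
      tsub_add_cancel_of_le (by simpa [Nat.one_le_iff_ne_zero] using hi)
    rw [coeff_pderiv, h2] at h1
    exact (mul_eq_zero.1 h1).resolve_right (Nat.cast_add_one_ne_zero _)

/-- If `p ∘ F = 0`, the chain rule and the nonsingular Jacobian give `(∂ᵢp) ∘ F = 0`. The partials
have lower degree, so they vanish by induction and `p` is constant. -/
theorem bind₁_injective {F : PolyMap} (hF : (jacobian F).det ≠ 0) :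
    Function.Injective (bind₁ F : MvPolynomial (Fin 2) ℂ →ₐ[ℂ] MvPolynomial (Fin 2) ℂ) := by
  rw [injective_iff_map_eq_zero]
  intro p
  induction hn : p.totalDegree using Nat.strong_induction_on generalizing p with
  | _ n ih =>
    intro hp
    have hvec : Matrix.vecMul (fun i => bind₁ F (pderiv i p)) (jacobian F) = 0 := by
      funext j
      have h := pderiv_bind₁ F j p
      rw [hp, map_zero] at h
      simpa [Matrix.vecMul, dotProduct, jacobian] using h.symm
    have hzero := Matrix.eq_zero_of_vecMul_eq_zero hF hvec
    have hpd : ∀ i, pderiv i p = 0 := by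
      intro i
      by_contra hne
      exact hne (ih _ (hn ▸ totalDegree_pderiv_lt hne) _ rfl (congrFun hzero i))
    rw [eq_C_of_pderiv_eq_zero hpd] at hp ⊢
    simpa using hp

/-- In `F ∘ G ∘ F = F`, injectivity of substitution cancels the right-hand `F`. -/
theorem mem_Aut_of_comp_eq_ident {F G : PolyMap} (hF : (jacobian F).det ≠ 0)
    (h : comp G F = ident) : F ∈ Aut := by
  refine ⟨G, funext fun i => bind₁_injective hF ?_, h⟩
  change comp (comp F G) F i = comp ident F i
  rw [comp_assoc, h, comp_ident, ident_comp]

/-- An étale map contracts no curve: if `F = c + q g`, the rows of the Jacobian are multiples of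
`∇q` modulo `q`, so `q` divides the determinant 1. -/
theorem not_dvd_sub_C {F : PolyMap} (hF : (jacobian F).det = 1)
    {q : MvPolynomial (Fin 2) ℂ} (hq : ¬ IsUnit q) (c : Fin 2 → ℂ) :
    ¬ ∀ i, q ∣ F i - C (c i) := by
  intro h
  choose g hg using h
  apply hq
  have hpd : ∀ i j, pderiv j (F i) = pderiv j q * g i + q * pderiv j (g i) := by
    intro i j
    have : F i = q * g i + C (c i) := by rw [← hg i]; ring
    rw [this, map_add, pderiv_mul, pderiv_C, add_zero]
  rw [Matrix.det_fin_two] at hF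
  simp only [jacobian, Matrix.of_apply, hpd] at hF
  rw [isUnit_iff_dvd_one, ← hF]
  refine ⟨pderiv 0 q * g 0 * pderiv 1 (g 1) + pderiv 0 (g 0) * pderiv 1 q * g 1
    + q * pderiv 0 (g 0) * pderiv 1 (g 1) - pderiv 1 q * g 0 * pderiv 0 (g 1)
    - pderiv 1 (g 0) * pderiv 0 q * g 1 - q * pderiv 1 (g 0) * pderiv 0 (g 1), ?_⟩
  ring

/-- A prime ideal of `K[X, Y]` containing two relatively prime polynomials is maximal. -/
theorem isMaximal_of_isRelPrime {K : Type*} [Field K] {a b : MvPolynomial (Fin 2) K}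
    (hab : IsRelPrime a b) (hb : b ≠ 0) {p : Ideal (MvPolynomial (Fin 2) K)} (hp : p.IsPrime)
    (ha' : a ∈ p) (hb' : b ∈ p) : p.IsMaximal := by
  obtain ⟨m, hm, hpm⟩ := Ideal.exists_le_maximal p hp.ne_top
  rcases hpm.eq_or_lt with rfl | hlt
  · exact hm
  -- Otherwise `0 < (π) < p < m` is a chain too long for dimension 2. Here `(π) ≠ p`, since `π`
  -- would divide both `a` and `b`.
  exfalso
  have hp0 : p ≠ ⊥ := fun h => hb (by simpa [h] using hb')
  obtain ⟨π, hπp, hπ⟩ := hp.exists_mem_prime_of_ne_bot hp0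
  have hπ' : (Ideal.span {π}).IsPrime := (Ideal.span_singleton_prime hπ.ne_zero).2 hπ
  have hle : Ideal.span {π} < p := by
    refine lt_of_le_of_ne ((Ideal.span_singleton_le_iff_mem _).2 hπp) fun h => ?_
    rw [← h, Ideal.mem_span_singleton] at ha' hb'
    exact hπ.not_isUnit (hab ha' hb')
  have hbot : (⊥ : Ideal (MvPolynomial (Fin 2) K)) < Ideal.span {π} := by
    rw [bot_lt_iff_ne_bot, Ne, Ideal.span_singleton_eq_bot]
    exact hπ.ne_zero
  let P0 : PrimeSpectrum (MvPolynomial (Fin 2) K) := ⟨⊥, Ideal.isPrime_bot⟩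
  let P1 : PrimeSpectrum (MvPolynomial (Fin 2) K) := ⟨_, hπ'⟩
  let P2 : PrimeSpectrum (MvPolynomial (Fin 2) K) := ⟨p, hp⟩
  let P3 : PrimeSpectrum (MvPolynomial (Fin 2) K) := ⟨m, hm.isPrime⟩
  have h01 : P0 < P1 := hbot
  have h12 : P1 < P2 := hle
  have h23 : P2 < P3 := hlt
  let s : LTSeries (PrimeSpectrum (MvPolynomial (Fin 2) K)) :=
    ⟨3, ![P0, P1, P2, P3], fun i => by fin_cases i; exacts [h01, h12, h23]⟩
  have hs := Order.LTSeries.length_le_krullDim s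
  have hdim : Order.krullDim (PrimeSpectrum (MvPolynomial (Fin 2) K)) = 2 := by
    have := MvPolynomial.ringKrullDim_of_isNoetherianRing (R := K) (ι := Fin 2)
    rw [ringKrullDim_eq_zero_of_field, zero_add, Nat.card_fin] at this
    exact this
  rw [hdim] at hs
  have hlen : s.length = 3 := rfl
  rw [hlen] at hs
  norm_cast at hs

/-- An irreducible factor `q` of `b ∘ F` also divides `a ∘ F`, so `(q)` contracts to a maximal
ideal, by the Nullstellensatz that of a point `c`. Then `F` contracts the curve `q = 0` to `c`. -/
theorem isUnit_bind₁_of_dvd {F : PolyMap} (hF : (jacobian F).det = 1)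
    {a b : MvPolynomial (Fin 2) ℂ} (hab : IsRelPrime a b) (hb : b ≠ 0)
    (h : bind₁ F b ∣ bind₁ F a) : IsUnit (bind₁ F b) := by
  have hinj := bind₁_injective (F := F) (hF ▸ one_ne_zero)
  by_contra hu
  obtain ⟨q, hq, hqb⟩ := WfDvdMonoid.exists_irreducible_factor hu
    ((map_ne_zero_iff _ hinj).2 hb)
  have hprime : (Ideal.span {q}).IsPrime :=
    (Ideal.span_singleton_prime hq.ne_zero).2 hq.prime
  have hmax : ((Ideal.span {q}).comap (bind₁ F)).IsMaximal :=
    isMaximal_of_isRelPrime hab hb (Ideal.comap_isPrime _ _)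
      (Ideal.mem_span_singleton.2 (hqb.trans h)) (Ideal.mem_span_singleton.2 hqb)
  obtain ⟨c, hc⟩ := isMaximal_iff_eq_vanishingIdeal_singleton.1 hmax
  refine not_dvd_sub_C hF hq.not_isUnit c fun i => ?_
  have hmem : (X i - C (c i) : MvPolynomial (Fin 2) ℂ) ∈ (Ideal.span {q}).comap (bind₁ F) := by
    rw [hc, mem_vanishingIdeal_singleton_iff]
    simp
  simpa [Ideal.mem_comap, Ideal.mem_span_singleton] using hmem

/-! ### The geometric degree -/

/-- The field `ℂ(X, Y)`. -/
abbrev RatFunc₂ : Type := FractionRing (MvPolynomial (Fin 2) ℂ)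

/-- The subfield `ℂ(P, Q)` of `ℂ(X, Y)` generated by the components of `F = (P, Q)`. -/
noncomputable def imageField (F : PolyMap) : IntermediateField ℂ RatFunc₂ :=
  IntermediateField.adjoin ℂ (Set.range fun i => algebraMap (MvPolynomial (Fin 2) ℂ) RatFunc₂ (F i))

/-- The geometric degree `[ℂ(X, Y) : ℂ(P, Q)]` of `F = (P, Q)`. -/
noncomputable def geomDegree (F : PolyMap) : ℕ := Module.finrank (imageField F) RatFunc₂

theorem algebraMap_bind₁_injective {F : PolyMap} (hF : (jacobian F).det ≠ 0) :
    Function.Injective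
      ((IsScalarTower.toAlgHom ℂ (MvPolynomial (Fin 2) ℂ) RatFunc₂).comp (bind₁ F)) :=
  (IsFractionRing.injective (MvPolynomial (Fin 2) ℂ) RatFunc₂).comp (bind₁_injective hF)

/-- The endomorphism `f ↦ f ∘ F` of `ℂ(X, Y)`. -/
noncomputable def pullback (F : PolyMap) (hF : (jacobian F).det ≠ 0) : RatFunc₂ →ₐ[ℂ] RatFunc₂ :=
  IsFractionRing.liftAlgHom (algebraMap_bind₁_injective hF)

theorem pullback_algebraMap (F : PolyMap) (hF : (jacobian F).det ≠ 0)
    (p : MvPolynomial (Fin 2) ℂ) :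
    pullback F hF (algebraMap _ _ p) = algebraMap _ _ (bind₁ F p) :=
  IsFractionRing.lift_algebraMap (algebraMap_bind₁_injective hF) p

theorem adjoin_X_eq_top :
    IntermediateField.adjoin ℂ
      (Set.range fun i => algebraMap (MvPolynomial (Fin 2) ℂ) RatFunc₂ (X i)) = ⊤ := by
  rw [eq_top_iff]
  rintro x -
  obtain ⟨a, b, -, rfl⟩ := IsFractionRing.div_surjective (A := MvPolynomial (Fin 2) ℂ) x
  have key : ∀ p : MvPolynomial (Fin 2) ℂ, algebraMap _ RatFunc₂ p ∈ IntermediateField.adjoin ℂ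
      (Set.range fun i => algebraMap (MvPolynomial (Fin 2) ℂ) RatFunc₂ (X i)) := by
    intro p
    induction p using MvPolynomial.induction_on with
    | C a => exact IntermediateField.algebraMap_mem _ a
    | add p q hp hq => rw [map_add]; exact add_mem hp hq
    | mul_X p i hp =>
      rw [map_mul]
      exact mul_mem hp (IntermediateField.subset_adjoin _ _ ⟨i, rfl⟩)
  exact div_mem (key a) (key b)

theorem imageField_eq_fieldRange {F : PolyMap} (hF : (jacobian F).det ≠ 0) :
    imageField F = (⊤ : IntermediateField ℂ RatFunc₂).map (pullback F hF) := by
  rw [← adjoin_X_eq_top, IntermediateField.adjoin_map, ← Set.range_comp, imageField]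
  congr 2
  funext i
  simp [pullback_algebraMap]

theorem imageField_comp (F : PolyMap) {G : PolyMap} (hG : (jacobian G).det ≠ 0) :
    imageField (comp F G) = (imageField F).map (pullback G hG) := by
  rw [imageField, imageField, IntermediateField.adjoin_map, ← Set.range_comp]
  congr 2
  funext i
  simp [pullback_algebraMap, comp]

/-- Pullback by `G` carries the extension defining the degree of `F` onto the lower step of the
tower through `imageField G`. -/
theorem geomDegree_comp (F : PolyMap) {G : PolyMap} (hG : (jacobian G).det ≠ 0) :
    geomDegree (comp F G) = geomDegree F * geomDegree G := by
  rw [geomDegree, geomDegree, geomDegree]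
  rw [← IntermediateField.relfinrank_mul_finrank_top
    (show imageField (comp F G) ≤ imageField G by
      rw [imageField_comp F hG, imageField_eq_fieldRange hG]
      exact IntermediateField.map_mono _ le_top)]
  rw [imageField_comp F hG]
  conv_lhs => rw [imageField_eq_fieldRange hG]
  rw [IntermediateField.relfinrank_map_map, IntermediateField.relfinrank_top_right,
    ← imageField_eq_fieldRange hG]

/-- As `finrank` is 0 on infinite extensions, the point is finiteness: `P, Q` form a transcendence
basis, and `ℂ(X, Y)` is finitely generated. -/
theorem geomDegree_pos {F : PolyMap} (hF : (jacobian F).det ≠ 0) : 0 < geomDegree F := by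
  have : Algebra.IsAlgebraic (MvPolynomial (Fin 2) ℂ) RatFunc₂ :=
    IsLocalization.isAlgebraic _ (nonZeroDivisors (MvPolynomial (Fin 2) ℂ))
  have hX : IsTranscendenceBasis ℂ
      fun i => algebraMap (MvPolynomial (Fin 2) ℂ) RatFunc₂ (X i) :=
    (IsTranscendenceBasis.mvPolynomial (Fin 2) ℂ).algebraMap_comp (A := RatFunc₂)
  have hind : AlgebraicIndependent ℂ
      fun i => algebraMap (MvPolynomial (Fin 2) ℂ) RatFunc₂ (F i) := by
    have h : AlgebraicIndependent ℂ F := bind₁_injective hF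
    exact h.map' (f := IsScalarTower.toAlgHom ℂ (MvPolynomial (Fin 2) ℂ) RatFunc₂)
      (IsFractionRing.injective _ _)
  have hbasis := hind.isTranscendenceBasis_of_lift_trdeg_le_of_finite
    (by rw [← hX.lift_cardinalMk_eq_trdeg])
  have halg : Algebra.IsAlgebraic (imageField F) RatFunc₂ := hbasis.isAlgebraic_field
  have hess : Algebra.EssFiniteType ℂ RatFunc₂ := inferInstance
  have : Algebra.EssFiniteType (imageField F) RatFunc₂ := Algebra.EssFiniteType.of_comp ℂ _ _
  have : Module.Finite (imageField F) RatFunc₂ :=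
    Algebra.finite_of_essFiniteType_of_isAlgebraic
  exact Module.finrank_pos

/-- Keller's theorem in the birational case. -/
theorem mem_Aut_of_geomDegree_eq_one {F : PolyMap} (hF : (jacobian F).det = 1)
    (h : geomDegree F = 1) : F ∈ Aut := by
  have hF' : (jacobian F).det ≠ 0 := hF ▸ one_ne_zero
  have htop : imageField F = ⊤ := by
    rw [geomDegree, ← IntermediateField.relfinrank_top_right,
      IntermediateField.relfinrank_eq_one_iff] at h
    exact top_le_iff.1 h
  have hX : ∀ i, ∃ p, bind₁ F p = X i := by
    intro i
    have hmem : algebraMap (MvPolynomial (Fin 2) ℂ) RatFunc₂ (X i) ∈ imageField F := by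
      rw [htop]; trivial
    rw [imageField_eq_fieldRange hF'] at hmem
    obtain ⟨x, -, hx⟩ := hmem
    -- In lowest terms `X i = (a / b) ∘ F`, so `b ∘ F` divides `a ∘ F` and is therefore a constant.
    obtain ⟨a, b, hab, rfl⟩ := IsFractionRing.exists_reduced_fraction (MvPolynomial (Fin 2) ℂ) x
    have hb : (b : MvPolynomial (Fin 2) ℂ) ≠ 0 := nonZeroDivisors.ne_zero b.2
    have hmul : bind₁ F a = bind₁ F b * X i := by
      apply IsFractionRing.injective (MvPolynomial (Fin 2) ℂ) RatFunc₂
      rw [map_mul, ← pullback_algebraMap F hF', ← pullback_algebraMap F hF']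
      rw [← hx, ← IsLocalization.mk'_spec' RatFunc₂ a b]
      exact map_mul (pullback F hF') _ _
    have hu := isUnit_bind₁_of_dvd hF hab hb ⟨_, hmul⟩
    rw [MvPolynomial.isUnit_iff_eq_C_of_isReduced] at hu
    obtain ⟨c, hc, hbc⟩ := hu
    refine ⟨C c⁻¹ * a, ?_⟩
    rw [map_mul, hmul, hbc, bind₁_C_right, ← mul_assoc, ← C_mul, inv_mul_cancel₀ hc.ne_zero, C_1,
      one_mul]
  choose G hG using hX
  exact mem_Aut_of_comp_eq_ident hF' (G := G) (funext hG)

theorem one_lt_geomDegree {F : PolyMap} (hF : F ∈ Et \ Aut) : 1 < geomDegree F := by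
  have hJ : (jacobian F).det = 1 := hF.1.1
  have h0 := geomDegree_pos (F := F) (hJ ▸ one_ne_zero)
  have h1 : geomDegree F ≠ 1 := fun h => hF.2 (mem_Aut_of_geomDegree_eq_one hJ h)
  omega

/-! ### Factorization into primes -/

theorem foldr_comp_append (L M : List PolyMap) :
    (L ++ M).foldr comp ident = comp (L.foldr comp ident) (M.foldr comp ident) := by
  induction L with
  | nil => simp [ident_comp]
  | cons F L ih => simp [ih, comp_assoc]

/-- Every normalized Keller mapping that is not an automorphism is a composition of primes. -/
theorem exists_prime_factorization {F : PolyMap} (hF : F ∈ Et \ Aut) :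
    ∃ L : List PolyMap, L ≠ [] ∧ (∀ P ∈ L, P ∈ EtPrime) ∧ F = L.foldr comp ident := by
  induction hn : geomDegree F using Nat.strong_induction_on generalizing F with
  | _ n ih =>
    by_cases hc : IsComposite F
    · obtain ⟨-, G, hG, H, hH, rfl⟩ := hc
      have hJ : (jacobian H).det = 1 := hH.1.1
      rw [geomDegree_comp G (hJ ▸ one_ne_zero)] at hn
      have h1 := one_lt_geomDegree hG
      have h2 := one_lt_geomDegree hH
      obtain ⟨L, hL, hLP, hGL⟩ := ih _ (by nlinarith) hG rfl
      obtain ⟨M, -, hMP, hHM⟩ := ih _ (by nlinarith) hH rfl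
      refine ⟨L ++ M, by simp [hL], ?_, by rw [foldr_comp_append, ← hGL, ← hHM]⟩
      intro P hP
      exact (List.mem_append.1 hP).elim (hLP P) (hMP P)
    · exact ⟨[F], by simp, by simpa using ⟨hF, hc⟩, by simp [comp_ident]⟩

end PlaneMap

theorem theorem4p5 :
    ((PlaneMap.Et \ PlaneMap.Aut).Nonempty → PlaneMap.EtPrime.Nonempty) ∧
    (∀ F ∈ PlaneMap.Et, ∃ k : ℕ, ∃ A₀ ∈ PlaneMap.Aut, ∃ P : Fin k → PlaneMap.PolyMap,
      (∀ i, P i ∈ PlaneMap.EtPrime) ∧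
      F = PlaneMap.comp A₀ (PlaneMap.compSeq P)) := by
  refine ⟨?_, fun F hF => ?_⟩
  · rintro ⟨F, hF⟩
    obtain ⟨L, hL, hLP, -⟩ := PlaneMap.exists_prime_factorization hF
    exact ⟨L.head hL, hLP _ (L.head_mem hL)⟩
  · by_cases hA : F ∈ PlaneMap.Aut
    · exact ⟨0, F, hA, Fin.elim0, fun i => i.elim0, by
        simp [PlaneMap.compSeq, PlaneMap.comp_ident]⟩
    · obtain ⟨L, -, hLP, hFL⟩ := PlaneMap.exists_prime_factorization ⟨hF, hA⟩
      refine ⟨L.length, PlaneMap.ident, PlaneMap.ident_mem_Aut, L.get,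
        fun i => hLP _ (L.get_mem i), ?_⟩
      rw [PlaneMap.ident_comp, PlaneMap.compSeq, List.ofFn_get]
      exact hFL
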